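/- Let $G$ be a compact Hausdorff group with normalized Haar measure $\mu$, let $\mathcal{H}$ be a finite-dimensional complex Hilbert space, and let $u$ be a (continuous) unitary projective representation of $G$ on $\mathcal{H}$: unitaries $u(g)$ with $u(g)u(h)\in\mathbb{T}\,u(gh)$ for all $g,h\in G$, such that $g\mapsto u(g)^*xu(g)$ is continuous for every $x\in\mathcal{B}(\mathcal{H})$. Let $N_{fix}=u(G)'=\{x\in\mathcal{B}(\mathcal{H}) : x\,u(g)=u(g)\,x \text{ for all } g\in G\}$, let $k:G\to[0,\infty)$ be measurable with $\int_G k\,d\mu=1$, and put $$\Phi_k(\rho)=\int_G k(g)\,u(g)^*\rho\,u(g)\,d\mu(g),\qquad E_{fix}(\rho)=\int_G u(g)^*\rho\,u(g)\,d\mu(g).$$ Write $\|x\|_p=\operatorname{Tr}(|x|^p)^{1/p}$ for $1\le p<\infty$ and $\|\cdot\|_\infty$ for the operator norm. Negative powers of a positive semidefinite operator are taken as generalized inverses (zero on the kernel), and the power with exponent $0$ is the identity. (1) For every positive semidefinite $\sigma\in N_{fix}$ (in particular every state $\sigma\in N_{fix}$), every positive semidefinite $\rho\in\mathcal{B}(\mathcal{H})$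 and all $p,\hat p\in[1,\infty]$ with $\frac1p+\frac1{\hat p}=1$, $$\|\sigma^{-1/2\hat p}\,\Phi_k(\rho)\,\sigma^{-1/2\hat p}\|_p\ \le\ \|k\|_{L_p(\mu)}\ \|\sigma^{-1/2\hat p}\,E_{fix}(\rho)\,\sigma^{-1/2\hat p}\|_p ,$$ as an inequality in $[0,\infty]$, with $\infty\cdot 0=0$. (2) For all states (positive semidefinite operators of trace one) $\rho\in\mathcal{B}(\mathcal{H})$ and $\sigma\in N_{fix}$, $$D(\Phi_k(\rho)\|\sigma)\ \le\ D(E_{fix}(\rho)\|\sigma)+\int_G k\log k\,d\mu$$ in $(-\infty,+\infty]$, where $D(\rho\|\sigma)=\operatorname{Tr}\,\rho(\log\rho-\log\sigma)$ if $\ker\sigma\subseteq\ker\rho$ and $D(\rho\|\sigma)=+\infty$ otherwise, and where the last integral is $+\infty$ if $k\log k$ is not integrable. -/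

import Mathlib

open MeasureTheory
open scoped ENNReal

noncomputable section

namespace Transference

variable {G : Type*} {H : Type*} [NormedAddCommGroup H] [InnerProductSpace ℂ H] [CompleteSpace H]

/-- A (continuous, unitary) projective representation of a topological group `G` on a Hilbert space
`H`: unitaries `u g` with `u g * u h` equal to `u (g * h)` up to a phase, such that the induced
action `g ↦ u(g)^* x u(g)` on operators is continuous. The lift `u` itself is not required to be
continuous, since a continuous lift need not exist. -/
structure IsProjectiveRep [Group G] [TopologicalSpace G] (u : G → unitary (H →L[ℂ] H)) : Prop where
  mul_phase : ∀ g h : G, ∃ c : ℂ, ‖c‖ = 1 ∧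
    (u g : H →L[ℂ] H) * (u h : H →L[ℂ] H) = c • (u (g * h) : H →L[ℂ] H)
  continuous_conj : ∀ x : H →L[ℂ] H,
    Continuous fun g : G => star (u g : H →L[ℂ] H) * x * (u g : H →L[ℂ] H)

/-- The fixed-point algebra `u(G)'`, the commutant of the operators `u g`. -/
def fixedAlgebra (u : G → unitary (H →L[ℂ] H)) : Subalgebra ℂ (H →L[ℂ] H) :=
  Subalgebra.centralizer ℂ (Set.range fun g : G => (u g : H →L[ℂ] H))

/-- `Φ_k(ρ) = ∫ k(g) u(g)^* ρ u(g) dμ(g)`. -/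
def transferMap [MeasurableSpace G] (μ : Measure G) (u : G → unitary (H →L[ℂ] H)) (k : G → ℝ)
    (ρ : H →L[ℂ] H) : H →L[ℂ] H :=
  ∫ g, (k g : ℂ) • (star (u g : H →L[ℂ] H) * ρ * (u g : H →L[ℂ] H)) ∂μ

/-- `E_fix(ρ) = ∫ u(g)^* ρ u(g) dμ(g)`, the conditional expectation onto the commutant of `u(G)`. -/
def fixExpectation [MeasurableSpace G] (μ : Measure G) (u : G → unitary (H →L[ℂ] H))
    (ρ : H →L[ℂ] H) : H →L[ℂ] H :=
  ∫ g, star (u g : H →L[ℂ] H) * ρ * (u g : H →L[ℂ] H) ∂μ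

/-- The trace of an operator (used on a finite-dimensional space). -/
def opTrace (x : H →L[ℂ] H) : ℂ := LinearMap.trace ℂ H (x : H →ₗ[ℂ] H)

/-- A density operator: positive semidefinite with trace one. -/
def IsState (ρ : H →L[ℂ] H) : Prop := 0 ≤ ρ ∧ opTrace ρ = 1

/-- The Schatten norm `(Tr |x|^p)^{1/p}` for `1 ≤ p < ∞`, and the operator norm for `p = ∞`. -/
def schattenNorm (p : ℝ≥0∞) (x : H →L[ℂ] H) : ℝ :=
  if p = ∞ then ‖x‖ else (opTrace (CFC.abs x ^ p.toReal)).re ^ (1 / p.toReal)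

/-- `σ^{-1/(2q)} x σ^{-1/(2q)}`, with `1/∞ = 0`. For negative exponents the power of a positive
semidefinite `σ` from the functional calculus is the generalized inverse: it is zero on the kernel
of `σ`, and the usual power on the support of `σ`. -/
def weighted (q : ℝ≥0∞) (σ x : H →L[ℂ] H) : H →L[ℂ] H :=
  σ ^ (-(q⁻¹.toReal / 2)) * x * σ ^ (-(q⁻¹.toReal / 2))

open Classical in
/-- The (Umegaki) relative entropy `Tr ρ (log ρ - log σ)`, equal to `+∞` unless the support of `ρ`
is contained in that of `σ` (that is, `ker σ ⊆ ker ρ`). Here `log` is the functional calculus with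
`log 0 = 0`, so that kernels contribute nothing. -/
def relEntropy (ρ σ : H →L[ℂ] H) : EReal :=
  if (σ : H →ₗ[ℂ] H).ker ≤ (ρ : H →ₗ[ℂ] H).ker then
    (((opTrace (ρ * (CFC.log ρ - CFC.log σ))).re : ℝ) : EReal)
  else ⊤

open Classical in
/-- `∫ k log k dμ` for a nonnegative function `k` on a probability space, as an element of
`(-∞, +∞]`: since `t log t` is bounded below, the integral is `+∞` when it is not finite. -/
def entropyIntegral [MeasurableSpace G] (μ : Measure G) (k : G → ℝ) : EReal :=
  if Integrable (fun g => k g * Real.log (k g)) μ then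
    ((∫ g, k g * Real.log (k g) ∂μ : ℝ) : EReal)
  else ⊤

end Transference

end

noncomputable section

namespace Transference

/-! ### Eigenbases, functional calculus and traces in finite dimension. -/

section Operators

open scoped InnerProductSpace ComplexOrder

set_option linter.unusedSectionVars false

variable {H : Type*} [NormedAddCommGroup H] [InnerProductSpace ℂ H] [CompleteSpace H]
  [FiniteDimensional ℂ H]

/-! Powers of `σ` commute with every `u g`, so the weights pass inside both averages and (1) reduces
to `‖Φ_k(X)‖_p ≤ ‖k‖_p ‖E(X)‖_p` for `X ≥ 0`, where `E = E_fix`. For `p = 1` this is a trace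
identity, for `p = ∞` it is `Φ_k(X) ≤ ‖k‖_∞ E(X)`.

For `1 < p < ∞` let `k` take the value `c m` on finitely many level sets, and let `X m` be the part
of `E(X)` averaged over the `m`-th one. Then `∑ X m = E(X)` and `∑ c m X m = Φ_k(X)`. The three
lines theorem gives `Tr (∑ c m X m)^p ≤ ∑ (c m)^p Tr (X m E(X)^(p-1))` (`opTrace_sum_rpow_le`).
Since `E(X)^(p-1)` lies in the commutant, the trace on the right is the measure of the level set
times `Tr E(X)^p`, so the right side is `∫ k^p · Tr E(X)^p`. General `k` follows by approximation
from below.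

For (2), the step function inequality is an equality at `p = 1`; differentiating there gives the
entropy inequality, which again passes to the limit. The `log σ` terms of the two relative entropies
agree because `log σ` lies in the commutant. -/

theorem opTrace_eq_sum_inner {ι : Type*} [Fintype ι] (b : OrthonormalBasis ι ℂ H) (x : H →L[ℂ] H) :
    opTrace x = ∑ i, ⟪b i, x (b i)⟫_ℂ := by
  rw [opTrace, LinearMap.trace_eq_sum_inner _ b]
  rfl

theorem opTrace_mul_comm (x y : H →L[ℂ] H) : opTrace (x * y) = opTrace (y * x) :=
  LinearMap.trace_mul_comm ℂ (x : H →ₗ[ℂ] H) (y : H →ₗ[ℂ] H)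

theorem finite_real_spectrum (A : H →L[ℂ] H) : (spectrum ℝ A).Finite := by
  have h : (spectrum ℂ A).Finite := by
    have := Module.End.finite_spectrum (A : H →ₗ[ℂ] H)
    rwa [← AlgEquiv.spectrum_eq (Module.End.toContinuousLinearMap H) (A : H →ₗ[ℂ] H)] at this
  have h2 := h.preimage (FaithfulSMul.algebraMap_injective ℝ ℂ).injOn
  rwa [spectrum.preimage_algebraMap] at h2

theorem aeval_apply_eigenvector (A : H →L[ℂ] H) (P : Polynomial ℝ) {t : ℝ} {v : H}
    (hv : A v = (t : ℂ) • v) : Polynomial.aeval A P v = ((P.eval t : ℝ) : ℂ) • v := by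
  induction P using Polynomial.induction_on' with
  | add p q hp hq => simp [hp, hq, add_smul]
  | monomial n a =>
    have h : ∀ n : ℕ, (A ^ n) v = ((t ^ n : ℝ) : ℂ) • v := by
      intro n
      induction n with
      | zero => simp
      | succ n ih => rw [pow_succ', mul_apply_eq_comp, ih, map_smul, hv, smul_smul]
                     push_cast; ring_nf
    rw [Polynomial.aeval_monomial, Algebra.algebraMap_eq_smul_one, smul_mul_assoc, one_mul,
      smul_apply, h, Polynomial.eval_monomial]
    push_cast
    rw [mul_smul]
    rfl

theorem mem_real_spectrum_of_eigenvector (A : H →L[ℂ] H) {t : ℝ} {v : H} (hv0 : v ≠ 0)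
    (hv : A v = (t : ℂ) • v) : t ∈ spectrum ℝ A := by
  intro hu
  obtain ⟨w, hw⟩ := hu
  apply hv0
  have h1 : (w : H →L[ℂ] H) v = 0 := by
    rw [hw, Algebra.algebraMap_eq_smul_one]
    simp only [sub_apply, smul_apply,
      one_apply_eq_self, hv]
    exact sub_self _
  have h2 : ((↑w⁻¹ : H →L[ℂ] H) * (w : H →L[ℂ] H)) v = v := by rw [Units.inv_mul]; rfl
  rw [← h2, mul_apply_eq_comp, h1, map_zero]

/-- The spectrum is finite, so `f` may be replaced by a Lagrange interpolation polynomial. No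
continuity of `f` is needed, which admits `log` at the eigenvalue zero. -/
theorem cfc_apply_eigenvector {A : H →L[ℂ] H} (hA : IsSelfAdjoint A) (f : ℝ → ℝ) {t : ℝ} {v : H}
    (hv : A v = (t : ℂ) • v) : cfc f A v = ((f t : ℝ) : ℂ) • v := by
  rcases eq_or_ne v 0 with rfl | hv0
  · simp
  have hfin := finite_real_spectrum A
  set P := Lagrange.interpolate hfin.toFinset id f with hP
  have hPe : ∀ s ∈ spectrum ℝ A, P.eval s = f s := fun s hs =>
    Lagrange.eval_interpolate_at_node f (Function.injective_id.injOn) (hfin.mem_toFinset.2 hs)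
  rw [← hPe t (mem_real_spectrum_of_eigenvector A hv0 hv),
    cfc_congr (g := fun s => P.eval s) (fun s hs => (hPe s hs).symm), cfc_polynomial P A hA]
  exact aeval_apply_eigenvector A P hv

theorem exists_eigenbasis {A : H →L[ℂ] H} (hA : 0 ≤ A) :
    ∃ (b : OrthonormalBasis (Fin (Module.finrank ℂ H)) ℂ H)
      (t : Fin (Module.finrank ℂ H) → ℝ), (∀ i, 0 ≤ t i) ∧ ∀ i, A (b i) = (t i : ℂ) • b i := by
  have hp := (ContinuousLinearMap.nonneg_iff_isPositive A).1 hA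
  have hs : (A : H →ₗ[ℂ] H).IsSymmetric := hp.isSymmetric
  refine ⟨hs.eigenvectorBasis rfl, hs.eigenvalues rfl, fun i => ?_, fun i => ?_⟩
  · have h := hp.inner_nonneg_right (hs.eigenvectorBasis rfl i)
    have h2 : A (hs.eigenvectorBasis rfl i) = _ := hs.apply_eigenvectorBasis rfl i
    rw [h2, inner_smul_right, inner_self_eq_norm_sq_to_K] at h
    simpa using h
  · exact hs.apply_eigenvectorBasis rfl i

theorem opTrace_cfc {ι : Type*} [Fintype ι] {A : H →L[ℂ] H} (hA : IsSelfAdjoint A)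
    (b : OrthonormalBasis ι ℂ H) {t : ι → ℝ} (hb : ∀ i, A (b i) = (t i : ℂ) • b i)
    (f : ℝ → ℝ) : opTrace (cfc f A) = ((∑ i, f (t i) : ℝ) : ℂ) := by
  rw [opTrace_eq_sum_inner b]
  simp [cfc_apply_eigenvector hA f (hb _)]

theorem opTrace_rpow {ι : Type*} [Fintype ι] {A : H →L[ℂ] H} (hA : 0 ≤ A)
    (b : OrthonormalBasis ι ℂ H) {t : ι → ℝ} (hb : ∀ i, A (b i) = (t i : ℂ) • b i)
    (p : ℝ) : opTrace (A ^ p) = ((∑ i, t i ^ p : ℝ) : ℂ) := by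
  rw [CFC.rpow_eq_cfc_real hA, opTrace_cfc hA.isSelfAdjoint b hb]

/-- The positive semidefinite form of a positive operator satisfies the polarised Cauchy–Schwarz
inequality. -/
theorem norm_inner_le_half_add {X : H →L[ℂ] H} (hX : 0 ≤ X) (x y : H) :
    ‖⟪x, X y⟫_ℂ‖ ≤ ((⟪x, X x⟫_ℂ).re + (⟪y, X y⟫_ℂ).re) / 2 := by
  obtain ⟨S, rfl⟩ := CStarAlgebra.nonneg_iff_eq_star_mul_self.1 hX
  have h : ∀ x y : H, ⟪x, (star S * S) y⟫_ℂ = ⟪S x, S y⟫_ℂ := fun x y => by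
    rw [mul_apply_eq_comp, ContinuousLinearMap.star_eq_adjoint,
      ContinuousLinearMap.adjoint_inner_right]
  have hs : ∀ x : H, (⟪S x, S x⟫_ℂ).re = ‖S x‖ ^ 2 := fun x => by
    exact inner_self_eq_norm_sq (𝕜 := ℂ) (S x)
  rw [h, h, h, hs, hs]
  nlinarith [norm_inner_le_norm (𝕜 := ℂ) (S x) (S y), sq_nonneg (‖S x‖ - ‖S y‖)]

theorem re_inner_nonneg {X : H →L[ℂ] H} (hX : 0 ≤ X) (x : H) : 0 ≤ (⟪x, X x⟫_ℂ).re := by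
  have := norm_inner_le_half_add hX x x
  linarith [norm_nonneg ⟪x, X x⟫_ℂ]

theorem apply_eq_zero_of_inner_eq_zero {X : H →L[ℂ] H} (hX : 0 ≤ X) {x : H} (hx : (⟪x, X x⟫_ℂ).re = 0) :
    X x = 0 := by
  obtain ⟨S, rfl⟩ := CStarAlgebra.nonneg_iff_eq_star_mul_self.1 hX
  have h : ⟪x, (star S * S) x⟫_ℂ = ⟪S x, S x⟫_ℂ := by
    rw [mul_apply_eq_comp, ContinuousLinearMap.star_eq_adjoint,
      ContinuousLinearMap.adjoint_inner_right]
  have : S x = 0 := by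
    have h2 := inner_self_eq_norm_sq (𝕜 := ℂ) (S x)
    rw [← h, RCLike.re_eq_complex_re, hx] at h2
    simpa using h2.symm
  simp [mul_apply_eq_comp, this]

/-- The operator that is diagonal in the orthonormal basis `b` with diagonal entries `d`. -/
def diagOp {ι : Type*} [Fintype ι] (b : OrthonormalBasis ι ℂ H) (d : ι → ℂ) : H →L[ℂ] H :=
  ∑ i, d i • InnerProductSpace.rankOne ℂ (b i) (b i)

variable {ι : Type*} [Fintype ι] (b : OrthonormalBasis ι ℂ H)

theorem diagOp_apply (d : ι → ℂ) (v : H) : diagOp b d v = ∑ i, (d i * ⟪b i, v⟫_ℂ) • b i := by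
  simp [diagOp, mul_smul]

theorem inner_diagOp (d : ι → ℂ) (i : ι) (v : H) :
    ⟪b i, diagOp b d v⟫_ℂ = d i * ⟪b i, v⟫_ℂ := by
  classical
  simp [diagOp_apply, b.inner_eq_ite]

theorem diagOp_apply_basis (d : ι → ℂ) (i : ι) : diagOp b d (b i) = d i • b i := by
  classical
  simp [diagOp_apply, b.inner_eq_ite]

theorem ext_basis {x y : H →L[ℂ] H} (h : ∀ i, x (b i) = y (b i)) : x = y := by
  ext v
  rw [← b.sum_repr v]
  simp [h]

theorem _root_.OrthonormalBasis.ext_inner_left_basis {x y : H} (h : ∀ i, ⟪b i, x⟫_ℂ = ⟪b i, y⟫_ℂ) :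
    x = y := by
  rw [← b.sum_repr x, ← b.sum_repr y]
  simp [b.repr_apply_apply, h]

theorem star_diagOp (d : ι → ℂ) : star (diagOp b d) = diagOp b (fun i => star (d i)) := by
  classical
  refine ext_basis b fun i => b.ext_inner_left_basis fun j => ?_
  rw [ContinuousLinearMap.star_eq_adjoint, ContinuousLinearMap.adjoint_inner_right,
    diagOp_apply_basis, diagOp_apply_basis, inner_smul_left, inner_smul_right, b.inner_eq_ite]
  split_ifs with h
  · simp [h]
  · simp

theorem re_inner_eq_sum {A : H →L[ℂ] H} {t : ι → ℝ} (hb : ∀ i, A (b i) = (t i : ℂ) • b i) (v : H) :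
    (⟪v, A v⟫_ℂ).re = ∑ i, t i * ‖⟪b i, v⟫_ℂ‖ ^ 2 := by
  have hA : A = diagOp b (fun i => (t i : ℂ)) :=
    ext_basis b fun i => by rw [hb, diagOp_apply_basis]
  rw [hA, diagOp_apply, inner_sum, Complex.re_sum]
  refine Finset.sum_congr rfl fun i _ => ?_
  rw [inner_smul_right, mul_assoc, ← inner_conj_symm v, Complex.mul_conj, Complex.normSq_eq_norm_sq,
    ← Complex.ofReal_mul, Complex.ofReal_re]

end Operators

/-! ### Complex powers of operators and the three lines theorem. -/

section ThreeLines

open scoped InnerProductSpace ComplexOrder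

set_option linter.unusedSectionVars false

/-- The complex power `t ^ z` of a nonnegative real number, with value zero at `t = 0` for every
exponent; it is an entire function of the exponent. -/
def genPow (t : ℝ) (z : ℂ) : ℂ := if t = 0 then 0 else Complex.exp (z * Real.log t)

theorem genPow_zero (z : ℂ) : genPow 0 z = 0 := by simp [genPow]

theorem genPow_ofReal {t : ℝ} (ht : 0 ≤ t) {s : ℝ} (hs : s ≠ 0) :
    genPow t s = ((t ^ s : ℝ) : ℂ) := by
  rcases ht.eq_or_lt with rfl | h
  · simp [genPow, Real.zero_rpow hs]
  · rw [genPow, if_neg h.ne', Real.rpow_def_of_pos h, Complex.ofReal_exp]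
    push_cast
    ring_nf

theorem norm_genPow_of_pos {t : ℝ} (ht : 0 < t) (z : ℂ) : ‖genPow t z‖ = t ^ z.re := by
  rw [genPow, if_neg ht.ne', Complex.norm_exp, Real.rpow_def_of_pos ht]
  simp [mul_comm]

theorem norm_genPow_le {t : ℝ} (ht : 0 ≤ t) (z : ℂ) : ‖genPow t z‖ ≤ t ^ z.re := by
  rcases ht.eq_or_lt with rfl | h
  · simpa [genPow_zero] using Real.rpow_nonneg le_rfl _
  · exact (norm_genPow_of_pos h z).le

theorem star_genPow (t : ℝ) (z : ℂ) : star (genPow t z) = genPow t (star z) := by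
  unfold genPow
  split_ifs
  · simp
  · simp [← Complex.exp_conj]

/-- Entire functions that are bounded on the strip `0 ≤ re z ≤ 1`. -/
def StripBounded (F : ℂ → ℂ) : Prop :=
  Differentiable ℂ F ∧ ∃ C, ∀ z : ℂ, 0 ≤ z.re → z.re ≤ 1 → ‖F z‖ ≤ C

theorem StripBounded.const (c : ℂ) : StripBounded fun _ => c :=
  ⟨differentiable_const c, ‖c‖, fun _ _ _ => le_rfl⟩

theorem StripBounded.mul {F F' : ℂ → ℂ} (h : StripBounded F) (h' : StripBounded F') :
    StripBounded fun z => F z * F' z := by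
  obtain ⟨hd, C, hC⟩ := h
  obtain ⟨hd', C', hC'⟩ := h'
  refine ⟨hd.mul hd', C * C', fun z h0 h1 => ?_⟩
  rw [norm_mul]
  exact mul_le_mul (hC z h0 h1) (hC' z h0 h1) (norm_nonneg _)
    ((norm_nonneg _).trans (hC z h0 h1))

theorem StripBounded.sum {ι : Type*} (s : Finset ι) {F : ι → ℂ → ℂ}
    (h : ∀ i ∈ s, StripBounded (F i)) : StripBounded fun z => ∑ i ∈ s, F i z := by
  classical
  induction s using Finset.induction_on with
  | empty => simpa using StripBounded.const 0
  | insert i s hi ih =>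
    obtain ⟨hd, C, hC⟩ := h i (Finset.mem_insert_self _ _)
    obtain ⟨hd', C', hC'⟩ := ih fun j hj => h j (Finset.mem_insert_of_mem hj)
    simp_rw [Finset.sum_insert hi]
    exact ⟨hd.add hd', C + C', fun z h0 h1 =>
      (norm_add_le _ _).trans (add_le_add (hC z h0 h1) (hC' z h0 h1))⟩

theorem StripBounded.genPow (t α β : ℝ) :
    StripBounded fun z => genPow t (α * z + β) := by
  by_cases ht : t = 0
  · simpa [Transference.genPow, ht] using StripBounded.const 0
  simp only [Transference.genPow, if_neg ht]
  refine ⟨by fun_prop, Real.exp ((|α| + |β|) * |Real.log t|), fun z h0 h1 => ?_⟩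
  rw [Complex.norm_exp]
  refine Real.exp_le_exp.2 ?_
  have : ((α * z + β) * Real.log t).re = (α * z.re + β) * Real.log t := by simp
  rw [this]
  refine (le_abs_self _).trans ?_
  rw [abs_mul]
  refine mul_le_mul_of_nonneg_right ((abs_add_le _ _).trans ?_) (abs_nonneg _)
  rw [abs_mul, abs_of_nonneg h0]
  nlinarith [abs_nonneg α]

theorem StripBounded.norm_le {F : ℂ → ℂ} (hF : StripBounded F) {a b s : ℝ}
    (hs0 : 0 ≤ s) (hs1 : s ≤ 1) (ha : ∀ z : ℂ, z.re = 0 → ‖F z‖ ≤ a)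
    (hb : ∀ z : ℂ, z.re = 1 → ‖F z‖ ≤ b) : ‖F s‖ ≤ a ^ (1 - s) * b ^ s := by
  obtain ⟨hd, C, hC⟩ := hF
  have := Complex.HadamardThreeLines.norm_le_interp_of_mem_verticalClosedStrip₀₁' F
    (z := (s : ℂ)) (a := a) (b := b) ⟨by simpa using hs0, by simpa using hs1⟩ hd.diffContOnCl
    ⟨C, ?_⟩ (fun z hz => ha z hz) (fun z hz => hb z hz)
  · simpa using this
  · rintro _ ⟨z, hz, rfl⟩
    exact hC z hz.1 hz.2

variable {H : Type*} [NormedAddCommGroup H] [InnerProductSpace ℂ H] [CompleteSpace H]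
  [FiniteDimensional ℂ H]

variable {ι : Type*} [Fintype ι] (e : OrthonormalBasis ι ℂ H)

theorem inner_diagOp_diagOp (d d' : ι → ℂ) (X : H →L[ℂ] H) (x y : H) :
    ⟪diagOp e d x, X (diagOp e d' y)⟫_ℂ =
      ∑ i, ∑ j, star (d i) * d' j * (⟪x, e i⟫_ℂ * ⟪e i, X (e j)⟫_ℂ * ⟪e j, y⟫_ℂ) := by
  rw [diagOp_apply, diagOp_apply, sum_inner]
  refine Finset.sum_congr rfl fun i _ => ?_
  rw [map_sum, inner_sum]
  refine Finset.sum_congr rfl fun j _ => ?_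
  rw [map_smul, inner_smul_left, inner_smul_right, map_mul, inner_conj_symm]
  simp only [RCLike.star_def]
  ring

/-- The inner product is conjugate linear in its first slot, so `star z` there makes the whole
expression holomorphic in `z`. -/
theorem stripBounded_inner (X : H →L[ℂ] H) (t : ι → ℝ) (α β : ℝ) (x y : H) :
    StripBounded fun z => ⟪diagOp e (fun i => genPow (t i) (α * star z + β)) x,
      X (diagOp e (fun i => genPow (t i) (α * z + β)) y)⟫_ℂ := by
  simp only [inner_diagOp_diagOp, star_genPow]
  refine StripBounded.sum _ fun i _ => StripBounded.sum _ fun j _ =>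
    (StripBounded.mul ?_ (StripBounded.genPow _ _ _)).mul (StripBounded.const _)
  simpa using StripBounded.genPow (t i) α β

variable {e} {E : H →L[ℂ] H} {ε : ι → ℝ} (hε : ∀ i, 0 ≤ ε i)
  (he : ∀ i, E (e i) = (ε i : ℂ) • e i)
include hε he

/-- On the line `re z = -1/2` the operators `E ^ z` satisfy `(E ^ z)^* E (E ^ z) ≤ 1`. -/
theorem re_inner_diagOp_le_one {w : ℂ} (hw : w.re = -1 / 2) {v : H} (hv : ‖v‖ = 1) :
    (⟪diagOp e (fun i => genPow (ε i) w) v, E (diagOp e (fun i => genPow (ε i) w) v)⟫_ℂ).re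
      ≤ 1 := by
  rw [re_inner_eq_sum e he]
  calc _ ≤ ∑ i, ‖⟪e i, v⟫_ℂ‖ ^ 2 := by
        refine Finset.sum_le_sum fun i _ => ?_
        rw [inner_diagOp, norm_mul, mul_pow, ← mul_assoc]
        refine mul_le_of_le_one_left (by positivity) ?_
        rcases (hε i).eq_or_lt with h | h
        · simp [← h]
        · rw [norm_genPow_of_pos h, hw, ← Real.rpow_mul_natCast h.le]
          norm_num [Real.rpow_neg_one, h.ne']
    _ = 1 := by rw [e.sum_sq_norm_inner_right, hv, one_pow]

/-- The sum is `Tr (T^* X T)`, and in `T T^*` the phases cancel, leaving `E ^ (2 re w)`. Hence the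
value is constant along the vertical line. -/
theorem sum_inner_diagOp_eq {κ : Type*} [Fintype κ] (f : OrthonormalBasis κ ℂ H) (hE : 0 ≤ E)
    {p : ℝ} (hp : 1 < p) {w : ℂ} (hw : w.re = (p - 1) / 2) (X : H →L[ℂ] H) :
    ∑ j, ⟪diagOp e (fun i => genPow (ε i) w) (f j),
      X (diagOp e (fun i => genPow (ε i) w) (f j))⟫_ℂ = opTrace (X * E ^ (p - 1)) := by
  set T := diagOp e (fun i => genPow (ε i) w)
  have hT : T * star T = E ^ (p - 1) := by
    refine ext_basis e fun i => ?_
    rw [CFC.rpow_eq_cfc_real hE, cfc_apply_eigenvector hE.isSelfAdjoint _ (he i),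
      mul_apply_eq_comp, star_diagOp, diagOp_apply_basis, map_smul, diagOp_apply_basis, smul_smul]
    congr 1
    rw [RCLike.star_def, ← Complex.normSq_eq_conj_mul_self, Complex.normSq_eq_norm_sq]
    congr 1
    rcases (hε i).eq_or_lt with h | h
    · simp [← h, genPow_zero, Real.zero_rpow (by linarith : p - 1 ≠ 0)]
    · rw [norm_genPow_of_pos h, hw, ← Real.rpow_mul_natCast h.le]
      norm_num
  rw [← hT, ← mul_assoc, opTrace_mul_comm, opTrace_eq_sum_inner f]
  refine Finset.sum_congr rfl fun j _ => ?_
  rw [mul_apply_eq_comp, mul_apply_eq_comp, ContinuousLinearMap.star_eq_adjoint,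
    ContinuousLinearMap.adjoint_inner_right]

-- With exponent `0`, `genPow` yields the support projection of `E`, not the identity. From `0 ≤ X ≤
-- E` it follows that `X` vanishes on the kernel of `E`, so the projection is invisible to `X`.
omit hε in
theorem inner_diagOp_support {X : H →L[ℂ] H} (hX : 0 ≤ X) (hXE : X ≤ E) (x : H) :
    ⟪diagOp e (fun i => genPow (ε i) 0) x, X (diagOp e (fun i => genPow (ε i) 0) x)⟫_ℂ
      = ⟪x, X x⟫_ℂ := by
  have h : X * diagOp e (fun i => genPow (ε i) 0) = X := by
    refine ext_basis e fun i => ?_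
    rw [mul_apply_eq_comp, diagOp_apply_basis, map_smul]
    by_cases hi : ε i = 0
    · have h2 := re_inner_nonneg (sub_nonneg.2 hXE) (e i)
      have h3 := re_inner_nonneg hX (e i)
      rw [sub_apply, he i, hi, inner_sub_right] at h2
      simp only [Complex.ofReal_zero, zero_smul, inner_zero_right, zero_sub, Complex.neg_re] at h2
      rw [apply_eq_zero_of_inner_eq_zero hX (le_antisymm (by linarith) h3), smul_zero]
    · simp [genPow, hi]
  have h1 : ∀ y, X (diagOp e (fun i => genPow (ε i) 0) y) = X y := fun y => by
    rw [← mul_apply_eq_comp, h]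
  have hs : ∀ x y, ⟪x, X y⟫_ℂ = ⟪X x, y⟫_ℂ := fun x y => by
    rw [← ContinuousLinearMap.adjoint_inner_right, ← ContinuousLinearMap.star_eq_adjoint,
      hX.isSelfAdjoint.star_eq]
  rw [h1, hs, h1, hs]

end ThreeLines

/-! ### The noncommutative Jensen inequality by interpolation. -/

section TraceInequality

open scoped InnerProductSpace ComplexOrder

variable {H : Type*} [NormedAddCommGroup H] [InnerProductSpace ℂ H] [CompleteSpace H]
  [FiniteDimensional ℂ H]

/-- A noncommutative Jensen inequality, equivalent to the data processing inequality for sandwiched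
Rényi divergences under a preparation channel. -/
theorem opTrace_sum_rpow_le {κ : Type*} (s : Finset κ) (X : κ → H →L[ℂ] H)
    (hX : ∀ m ∈ s, 0 ≤ X m) (c : κ → ℝ) (hc : ∀ m ∈ s, 0 ≤ c m) {p : ℝ} (hp : 1 < p) :
    (opTrace ((∑ m ∈ s, (c m : ℂ) • X m) ^ p)).re ≤
      ∑ m ∈ s, c m ^ p * (opTrace (X m * (∑ m ∈ s, X m) ^ (p - 1))).re := by
  set E := ∑ m ∈ s, X m with hEdef
  set A := ∑ m ∈ s, (c m : ℂ) • X m with hAdef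
  have hE : 0 ≤ E := Finset.sum_nonneg hX
  have hA : 0 ≤ A := Finset.sum_nonneg fun m hm =>
    smul_nonneg (by exact_mod_cast hc m hm) (hX m hm)
  obtain ⟨e, ε, hε, he⟩ := exists_eigenbasis hE
  obtain ⟨f, a, ha, hf⟩ := exists_eigenbasis hA
  have hp0 : 0 < p := by linarith
  rw [opTrace_rpow hA f hf, Complex.ofReal_re]
  set S := ∑ j, a j ^ p with hS
  have hS0 : 0 ≤ S := Finset.sum_nonneg fun j _ => Real.rpow_nonneg (ha j) _
  set M := ∑ m ∈ s, c m ^ p * (opTrace (X m * E ^ (p - 1))).re with hM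
  -- This is `E ^ ((p z - 1) / 2)`: its exponent has real part `-1/2` on `re z = 0` and `(p - 1)/2`
  -- on `re z = 1`, and it vanishes at `z = 1/p`.
  let T : ℂ → H →L[ℂ] H := fun z =>
    diagOp e (fun i => genPow (ε i) ((p / 2 : ℝ) * z + (-1 / 2 : ℝ)))
  have hTre : ∀ z : ℂ, ((p / 2 : ℝ) * z + (-1 / 2 : ℝ) : ℂ).re = p / 2 * z.re - 1 / 2 := by
    intro z; simp; ring
  have hT1 : ∀ z : ℂ, z.re = 1 → ∀ m,
      (∑ j, (⟪T z (f j), X m (T z (f j))⟫_ℂ).re) = (opTrace (X m * E ^ (p - 1))).re := by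
    intro z hz m
    rw [← Complex.re_sum, sum_inner_diagOp_eq hε he f hE hp (by rw [hTre, hz]; ring)]
  have hM0 : 0 ≤ M := Finset.sum_nonneg fun m hm =>
    mul_nonneg (Real.rpow_nonneg (hc m hm) _) (by
      rw [← hT1 1 (by simp)]
      exact Finset.sum_nonneg fun j _ => re_inner_nonneg (hX m hm) _)
  -- In the eigenbasis of `A` this is `∑ m, c m ^ (p z) Tr (A ^ (p (1 - z)) T(z̄)^* X m T(z))`. It
  -- is bounded by `S` and `M` on the two boundary lines and equals `S` at `z = 1/p`.
  let F : ℂ → ℂ := fun z => ∑ m ∈ s, ∑ j, genPow (c m) ((p : ℝ) * z + (0 : ℝ)) *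
    genPow (a j) ((-p : ℝ) * z + (p : ℝ)) * ⟪T (star z) (f j), X m (T z (f j))⟫_ℂ
  have hF : StripBounded F := StripBounded.sum _ fun m _ => StripBounded.sum _ fun j _ =>
    ((StripBounded.genPow _ _ _).mul (StripBounded.genPow _ _ _)).mul
      (stripBounded_inner e (X m) ε _ _ _ _)
  have hFle : ∀ z : ℂ, ‖F z‖ ≤ ∑ m ∈ s, ∑ j, c m ^ (p * z.re) * a j ^ (p - p * z.re) *
      (((⟪T (star z) (f j), X m (T (star z) (f j))⟫_ℂ).re +
        (⟪T z (f j), X m (T z (f j))⟫_ℂ).re) / 2) := by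
    intro z
    refine (norm_sum_le _ _).trans (Finset.sum_le_sum fun m hm => (norm_sum_le _ _).trans
      (Finset.sum_le_sum fun j _ => ?_))
    rw [norm_mul, norm_mul]
    have h1 : ‖genPow (c m) ((p : ℝ) * z + (0 : ℝ))‖ ≤ c m ^ (p * z.re) := by
      simpa using norm_genPow_le (hc m hm) ((p : ℝ) * z + (0 : ℝ))
    have h2 : ‖genPow (a j) ((-p : ℝ) * z + (p : ℝ))‖ ≤ a j ^ (p - p * z.re) := by
      have := norm_genPow_le (ha j) ((-p : ℝ) * z + (p : ℝ))
      rwa [show (((-p : ℝ) : ℂ) * z + (p : ℝ)).re = p - p * z.re by simp; ring] at this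
    exact mul_le_mul (mul_le_mul h1 h2 (norm_nonneg _) (Real.rpow_nonneg (hc m hm) _))
      (norm_inner_le_half_add (hX m hm) _ _) (norm_nonneg _)
      (mul_nonneg (Real.rpow_nonneg (hc m hm) _) (Real.rpow_nonneg (ha j) _))
  -- The factors in `c m` have been bounded by `1`, so summing the `X m` restores `E`, and `T(z)^* E
  -- T(z) ≤ 1` on this line.
  have hF0 : ∀ z : ℂ, z.re = 0 → ‖F z‖ ≤ S := by
    intro z hz
    refine (hFle z).trans ?_
    rw [Finset.sum_comm]
    refine Finset.sum_le_sum fun j _ => ?_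
    simp only [hz, mul_zero, Real.rpow_zero, one_mul, sub_zero]
    rw [← Finset.mul_sum]
    refine mul_le_of_le_one_right (Real.rpow_nonneg (ha j) _) ?_
    have hsum : ∀ x : H, ∑ m ∈ s, (⟪x, X m x⟫_ℂ).re = (⟪x, E x⟫_ℂ).re := fun x => by
      rw [hEdef, sum_apply, inner_sum, Complex.re_sum]
    rw [← Finset.sum_div, Finset.sum_add_distrib, hsum, hsum]
    have h1 := re_inner_diagOp_le_one hε he (w := (p / 2 : ℝ) * z + (-1 / 2 : ℝ))
      (by rw [hTre, hz]; ring) (f.norm_eq_one j)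
    have h2 := re_inner_diagOp_le_one hε he (w := (p / 2 : ℝ) * star z + (-1 / 2 : ℝ))
      (by rw [hTre]; simp [hz]; ring) (f.norm_eq_one j)
    exact (div_le_one two_pos).2 ((add_le_add h2 h1).trans_eq one_add_one_eq_two)
  have hF1 : ∀ z : ℂ, z.re = 1 → ‖F z‖ ≤ M := by
    intro z hz
    refine (hFle z).trans (Finset.sum_le_sum fun m hm => ?_)
    simp only [hz, mul_one, sub_self, Real.rpow_zero]
    rw [← Finset.mul_sum, ← Finset.sum_div, Finset.sum_add_distrib, hT1 z hz,
      hT1 (star z) (by simpa using hz)]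
    refine le_of_eq ?_
    ring
  -- The powers become `c m` and `a j ^ (p - 1)`, so summing over `m` gives `∑ j, a j ^ (p - 1) ⟪f
  -- j, A (f j)⟫`.
  have hinv : F ((1 / p : ℝ) : ℂ) = (S : ℂ) := by
    have hTs : T ((1 / p : ℝ) : ℂ) = diagOp e (fun i => genPow (ε i) 0) := by
      have : (((p / 2 : ℝ) : ℂ) * ((1 / p : ℝ) : ℂ) + ((-1 / 2 : ℝ) : ℂ)) = 0 := by
        rw [← Complex.ofReal_mul, ← Complex.ofReal_add, Complex.ofReal_eq_zero]
        field_simp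
        ring
      simp only [T, this]
    have hstar : star ((1 / p : ℝ) : ℂ) = ((1 / p : ℝ) : ℂ) := Complex.conj_ofReal _
    have e1 : ((p : ℝ) : ℂ) * ((1 / p : ℝ) : ℂ) + ((0 : ℝ) : ℂ) = ((1 : ℝ) : ℂ) := by
      rw [← Complex.ofReal_mul, ← Complex.ofReal_add]
      congr 1; field_simp; ring
    have e2 : ((-p : ℝ) : ℂ) * ((1 / p : ℝ) : ℂ) + ((p : ℝ) : ℂ) = ((p - 1 : ℝ) : ℂ) := by
      rw [← Complex.ofReal_mul, ← Complex.ofReal_add]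
      congr 1; field_simp; ring
    simp only [F, hstar, hTs, e1, e2]
    rw [Finset.sum_comm, hS, Complex.ofReal_sum]
    refine Finset.sum_congr rfl fun j _ => ?_
    have h3 : ∀ m ∈ s, genPow (c m) ((1 : ℝ) : ℂ) * genPow (a j) ((p - 1 : ℝ) : ℂ) *
        ⟪diagOp e (fun i => genPow (ε i) 0) (f j),
          X m (diagOp e (fun i => genPow (ε i) 0) (f j))⟫_ℂ =
        ((a j ^ (p - 1) : ℝ) : ℂ) * ⟪f j, ((c m : ℂ) • X m) (f j)⟫_ℂ := by
      intro m hm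
      rw [inner_diagOp_support he (hX m hm) (Finset.single_le_sum hX hm),
        genPow_ofReal (hc m hm) one_ne_zero, Real.rpow_one,
        genPow_ofReal (ha j) (by linarith : p - 1 ≠ 0), smul_apply, inner_smul_right]
      ring
    rw [Finset.sum_congr rfl h3, ← Finset.mul_sum, ← inner_sum, ← sum_apply, ← hAdef, hf j,
      inner_smul_right, f.inner_eq_one, mul_one, ← Complex.ofReal_mul]
    congr 1
    rcases (ha j).eq_or_lt with h | h
    · simp [← h, Real.zero_rpow hp0.ne']
    · rw [← Real.rpow_add_one h.ne']
      congr 1; ring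
  -- This reads `S ≤ S ^ (1 - 1/p) * M ^ (1/p)`; cancelling a positive `S` gives `S ≤ M`.
  have h := hF.norm_le (s := 1 / p) (by positivity) (by rw [div_le_one hp0]; exact hp.le) hF0 hF1
  rw [hinv, Complex.norm_real, Real.norm_of_nonneg hS0] at h
  rcases hS0.eq_or_lt with hS0 | hS0
  · rw [← hS0]; exact hM0
  have h4 : S ^ (1 - 1 / p) * S ^ (1 / p) = S := by
    rw [← Real.rpow_add hS0]; simp
  have h5 : S ^ (1 / p) ≤ M ^ (1 / p) := by
    refine le_of_mul_le_mul_left ?_ (Real.rpow_pos_of_pos hS0 (1 - 1 / p))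
    rw [h4]; exact h
  exact (Real.rpow_le_rpow_iff hS0.le hM0 (by positivity)).1 h5

end TraceInequality

/-! ### Averages over the group and the commutant. -/

section Averaging

open scoped ComplexOrder Topology
open Filter

set_option linter.unusedSectionVars false

variable {H : Type*} [NormedAddCommGroup H] [InnerProductSpace ℂ H] [CompleteSpace H]
  [FiniteDimensional ℂ H]

theorem mul_rpow_sub_one {A : H →L[ℂ] H} (hA : 0 ≤ A) {p : ℝ} (hp : 1 < p) :
    A * A ^ (p - 1) = A ^ p := by
  obtain ⟨b, t, ht, hb⟩ := exists_eigenbasis hA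
  refine ext_basis b fun i => ?_
  rw [mul_apply_eq_comp, CFC.rpow_eq_cfc_real hA, CFC.rpow_eq_cfc_real hA,
    cfc_apply_eigenvector hA.isSelfAdjoint _ (hb i),
    cfc_apply_eigenvector hA.isSelfAdjoint _ (hb i), map_smul, hb, smul_smul,
    ← Complex.ofReal_mul]
  congr 2
  rcases (ht i).eq_or_lt with h | h
  · simp [← h, Real.zero_rpow (by linarith : p ≠ 0)]
  · rw [← Real.rpow_add_one h.ne', sub_add_cancel]

/-- The functional `x ↦ Tr (x L)` as a continuous linear map. -/
def traceMul (L : H →L[ℂ] H) : (H →L[ℂ] H) →L[ℂ] ℂ :=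
  LinearMap.toContinuousLinearMap
    { toFun := fun x => opTrace (x * L)
      map_add' := fun x y => by simp [opTrace, add_mul]
      map_smul' := fun c x => by simp [opTrace] }

theorem traceMul_apply (L x : H →L[ℂ] H) : traceMul L x = opTrace (x * L) := rfl

theorem continuous_opTrace : Continuous (opTrace : (H →L[ℂ] H) → ℂ) := by
  simpa [traceMul_apply, Function.comp_def] using! (traceMul (1 : H →L[ℂ] H)).continuous

theorem tendsto_opTrace_cfc {A : ℕ → H →L[ℂ] H} {B : H →L[ℂ] H} (hA : ∀ n, IsSelfAdjoint (A n))
    (hB : IsSelfAdjoint B) (h : Tendsto A atTop (𝓝 B)) {f : ℝ → ℝ} (hf : Continuous f) :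
    Tendsto (fun n => opTrace (cfc f (A n))) atTop (𝓝 (opTrace (cfc f B))) := by
  -- Convergence confines all but finitely many spectra to one compact ball. The factor `‖1‖` covers
  -- the zero space, where it is `0`.
  have h1 : Tendsto (fun n => ‖A n‖ * ‖(1 : H →L[ℂ] H)‖) atTop (𝓝 (‖B‖ * ‖(1 : H →L[ℂ] H)‖)) :=
    h.norm.mul_const _
  have h2 := h1.eventually (gt_mem_nhds (lt_add_one _))
  refine (continuous_opTrace.tendsto _).comp (h.cfc
    (isCompact_closedBall (0 : ℝ) (‖B‖ * ‖(1 : H →L[ℂ] H)‖ + 1)) f ?_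
    (Eventually.of_forall hA) ?_ hB hf.continuousOn)
  · filter_upwards [h2] with n hn x hx
    exact mem_closedBall_zero_iff.2 ((spectrum.norm_le_norm_mul_of_mem hx).trans hn.le)
  · intro x hx
    exact mem_closedBall_zero_iff.2 ((spectrum.norm_le_norm_mul_of_mem hx).trans
      (lt_add_one _).le)

variable {G : Type*} [Group G] [TopologicalSpace G] [IsTopologicalGroup G] [CompactSpace G]
  [MeasurableSpace G] [BorelSpace G] {μ : Measure G} [IsProbabilityMeasure μ]
  {u : G → unitary (H →L[ℂ] H)}

theorem mem_fixedAlgebra_iff {x : H →L[ℂ] H} :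
    x ∈ fixedAlgebra u ↔ ∀ g, Commute (u g : H →L[ℂ] H) x := by
  simp [fixedAlgebra, Subalgebra.mem_centralizer_iff, Commute, SemiconjBy]

theorem commute_star_of_mem {x : H →L[ℂ] H} (hx : x ∈ fixedAlgebra u) (g : G) :
    Commute (star (u g : H →L[ℂ] H)) x := by
  have h := (mem_fixedAlgebra_iff.1 hx g).eq
  have h1 : star (u g : H →L[ℂ] H) * (u g : H →L[ℂ] H) = 1 := Unitary.coe_star_mul_self _
  have h2 : (u g : H →L[ℂ] H) * star (u g : H →L[ℂ] H) = 1 := Unitary.coe_mul_star_self _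
  calc star (u g : H →L[ℂ] H) * x
      = star (u g : H →L[ℂ] H) * x * ((u g : H →L[ℂ] H) * star (u g : H →L[ℂ] H)) := by
        rw [h2, mul_one]
    _ = star (u g : H →L[ℂ] H) * (x * (u g : H →L[ℂ] H)) * star (u g : H →L[ℂ] H) := by
        simp only [mul_assoc]
    _ = x * star (u g : H →L[ℂ] H) := by rw [← h, ← mul_assoc, h1, one_mul]

theorem cfc_mem_fixedAlgebra {x : H →L[ℂ] H} (hx : x ∈ fixedAlgebra u) (f : ℝ → ℝ) :
    cfc f x ∈ fixedAlgebra u :=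
  mem_fixedAlgebra_iff.2 fun g => ((mem_fixedAlgebra_iff.1 hx g).symm.cfc_real f).symm

theorem rpow_mem_fixedAlgebra {x : H →L[ℂ] H} (hx : x ∈ fixedAlgebra u) (hx0 : 0 ≤ x) (r : ℝ) :
    x ^ r ∈ fixedAlgebra u := by
  rw [CFC.rpow_eq_cfc_real hx0]
  exact cfc_mem_fixedAlgebra hx _

/-- `star (u g) * x * u g` -/
def conjAct (u : G → unitary (H →L[ℂ] H)) (x : H →L[ℂ] H) (g : G) : H →L[ℂ] H :=
  star (u g : H →L[ℂ] H) * x * (u g : H →L[ℂ] H)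

theorem norm_conjAct (x : H →L[ℂ] H) (g : G) : ‖conjAct u x g‖ = ‖x‖ := by
  rw [conjAct, CStarRing.norm_mul_coe_unitary, ← Unitary.coe_star, CStarRing.norm_coe_unitary_mul]

theorem conjAct_nonneg {x : H →L[ℂ] H} (hx : 0 ≤ x) (g : G) : 0 ≤ conjAct u x g :=
  star_left_conjugate_nonneg hx _

theorem opTrace_conjAct_mul (x : H →L[ℂ] H) {L : H →L[ℂ] H} (hL : L ∈ fixedAlgebra u) (g : G) :
    opTrace (conjAct u x g * L) = opTrace (x * L) := by
  have h2 : (u g : H →L[ℂ] H) * star (u g : H →L[ℂ] H) = 1 := Unitary.coe_mul_star_self _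
  rw [conjAct, mul_assoc, mul_assoc, opTrace_mul_comm, (mem_fixedAlgebra_iff.1 hL g).eq,
    mul_assoc, mul_assoc, h2, mul_one]

theorem conjAct_mul_mul (x : H →L[ℂ] H) {L : H →L[ℂ] H} (hL : L ∈ fixedAlgebra u) (g : G) :
    conjAct u (L * x * L) g = L * conjAct u x g * L := by
  rw [conjAct, conjAct, ← mul_assoc, ← mul_assoc, (commute_star_of_mem hL g).eq, mul_assoc _ L,
    ← (mem_fixedAlgebra_iff.1 hL g).eq]
  simp only [mul_assoc]

theorem transferMap_eq (k : G → ℝ) (x : H →L[ℂ] H) :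
    transferMap μ u k x = ∫ g, (k g : ℂ) • conjAct u x g ∂μ := rfl

theorem fixExpectation_eq_transferMap (x : H →L[ℂ] H) :
    fixExpectation μ u x = transferMap μ u (fun _ => 1) x := by
  simp [transferMap, fixExpectation]

variable (hu : IsProjectiveRep u)
include hu

/-- The phase meets its conjugate and cancels, so a projective representation still gives a genuine
right action on operators. -/
theorem conjAct_conjAct (x : H →L[ℂ] H) (g h : G) :
    conjAct u (conjAct u x g) h = conjAct u x (g * h) := by
  obtain ⟨c, hc, hgh⟩ := hu.mul_phase g h
  have h1 : conjAct u (conjAct u x g) h =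
      star ((u g : H →L[ℂ] H) * (u h : H →L[ℂ] H)) * x *
        ((u g : H →L[ℂ] H) * (u h : H →L[ℂ] H)) := by
    simp only [conjAct, star_mul, mul_assoc]
  have hcc : star c * c = 1 := by
    rw [RCLike.star_def, ← Complex.normSq_eq_conj_mul_self, Complex.normSq_eq_norm_sq, hc]
    simp
  rw [h1, hgh, star_smul, smul_mul_assoc, smul_mul_assoc, mul_smul_comm, smul_smul, hcc, one_smul,
    conjAct]

theorem aestronglyMeasurable_conjAct (x : H →L[ℂ] H) :
    AEStronglyMeasurable (conjAct u x) μ :=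
  (hu.continuous_conj x).aestronglyMeasurable

theorem integrable_smul_conjAct {k : G → ℝ} (hk : Integrable k μ) (x : H →L[ℂ] H) :
    Integrable (fun g => (k g : ℂ) • conjAct u x g) μ :=
  ((hk.ofReal (𝕜 := ℂ)).smul_bdd ‖x‖ (aestronglyMeasurable_conjAct hu x)
    (Eventually.of_forall fun g => (norm_conjAct x g).le)).congr (Eventually.of_forall fun _ => rfl)

/-- Tracing against `L` in the commutant cannot see the conjugation. The cases that matter are `L =
1`, `L = E(X)^(p-1)` and `L = log σ`. -/
theorem opTrace_transferMap_mul {k : G → ℝ} (hk : Integrable k μ) (x : H →L[ℂ] H)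
    {L : H →L[ℂ] H} (hL : L ∈ fixedAlgebra u) :
    opTrace (transferMap μ u k x * L) = ((∫ g, k g ∂μ : ℝ) : ℂ) * opTrace (x * L) := by
  rw [transferMap_eq, ← traceMul_apply,
    ← ContinuousLinearMap.integral_comp_comm _ (integrable_smul_conjAct hu hk x)]
  simp_rw [map_smul, traceMul_apply, opTrace_conjAct_mul x hL, smul_eq_mul]
  rw [integral_mul_const, integral_complex_ofReal]

theorem transferMap_mul_mul {k : G → ℝ} (hk : Integrable k μ) (x : H →L[ℂ] H)
    {L : H →L[ℂ] H} (hL : L ∈ fixedAlgebra u) :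
    transferMap μ u k (L * x * L) = L * transferMap μ u k x * L := by
  have h := ContinuousLinearMap.integral_comp_comm
    ((ContinuousLinearMap.mul ℂ (H →L[ℂ] H) L).comp
      ((ContinuousLinearMap.mul ℂ (H →L[ℂ] H)).flip L)) (integrable_smul_conjAct hu hk x)
  simp only [transferMap_eq, conjAct_mul_mul x hL]
  simp only [ContinuousLinearMap.comp_apply, ContinuousLinearMap.flip_apply,
    ContinuousLinearMap.mul_apply'] at h
  rw [mul_assoc, ← h]
  simp [mul_assoc]

omit hu in
theorem transferMap_nonneg {k : G → ℝ} (hk0 : ∀ g, 0 ≤ k g) {x : H →L[ℂ] H} (hx : 0 ≤ x) :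
    0 ≤ transferMap μ u k x :=
  integral_nonneg fun g => smul_nonneg (by exact_mod_cast hk0 g) (conjAct_nonneg hx g)

theorem transferMap_sum {κ : Type*} (s : Finset κ) (c : κ → ℝ) {k : κ → G → ℝ}
    (hk : ∀ m ∈ s, Integrable (k m) μ) (x : H →L[ℂ] H) :
    ∑ m ∈ s, (c m : ℂ) • transferMap μ u (k m) x =
      transferMap μ u (fun g => ∑ m ∈ s, c m * k m g) x := by
  simp only [transferMap_eq]
  push_cast
  simp_rw [Finset.sum_smul]
  rw [integral_finsetSum]
  · refine Finset.sum_congr rfl fun m hm => ?_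
    rw [← integral_smul]
    simp_rw [mul_smul]
  · intro m hm
    refine ((integrable_smul_conjAct hu (hk m hm) x).smul (c m : ℂ)).congr
      (Eventually.of_forall fun g => ?_)
    exact (mul_smul (c m : ℂ) (k m g : ℂ) (conjAct u x g)).symm

theorem fixExpectation_mem [μ.IsHaarMeasure] (x : H →L[ℂ] H) :
    fixExpectation μ u x ∈ fixedAlgebra u := by
  refine mem_fixedAlgebra_iff.2 fun h => ?_
  -- Unimodularity: a right translate of Haar measure is again a Haar probability measure, hence
  -- equal to it.
  have hmap : μ.map (fun g => g * h) = μ := by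
    have : IsProbabilityMeasure (μ.map fun g => g * h) :=
      Measure.isProbabilityMeasure_map (measurable_mul_const h).aemeasurable
    exact Measure.isHaarMeasure_eq_of_isProbabilityMeasure (μ.map fun g => g * h) μ
  have hE : conjAct u (fixExpectation μ u x) h = fixExpectation μ u x := by
    have hint : Integrable (conjAct u x) μ := by
      simpa using integrable_smul_conjAct hu (k := fun _ => 1) (integrable_const 1) x
    have h1 := ContinuousLinearMap.integral_comp_comm
      ((ContinuousLinearMap.mul ℂ (H →L[ℂ] H) (star (u h : H →L[ℂ] H))).comp
        ((ContinuousLinearMap.mul ℂ (H →L[ℂ] H)).flip (u h : H →L[ℂ] H))) hint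
    have h2 : ∀ y : H →L[ℂ] H, ((ContinuousLinearMap.mul ℂ (H →L[ℂ] H)
        (star (u h : H →L[ℂ] H))).comp ((ContinuousLinearMap.mul ℂ (H →L[ℂ] H)).flip
          (u h : H →L[ℂ] H))) y = conjAct u y h := fun y => by
      simp [conjAct, mul_assoc]
    simp only [h2, conjAct_conjAct hu] at h1
    change conjAct u (∫ g, conjAct u x g ∂μ) h = ∫ g, conjAct u x g ∂μ
    rw [← h1]
    conv_rhs => rw [← hmap]
    exact (integral_map (measurable_mul_const h).aemeasurable
      (hu.continuous_conj x).aestronglyMeasurable).symm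
  have h2 : (u h : H →L[ℂ] H) * star (u h : H →L[ℂ] H) = 1 := Unitary.coe_mul_star_self _
  change _ = _
  conv_lhs => rw [← hE, conjAct, ← mul_assoc, ← mul_assoc, h2, one_mul]

end Averaging

/-! ### Approximation by step functions, and derivatives in the exponent. -/

section StepFunctions

open scoped Topology
open Filter

set_option linter.unusedSectionVars false

variable {G : Type*} [MeasurableSpace G] {μ : Measure G} [IsProbabilityMeasure μ]

theorem integrable_ite_eq {j : G → ℕ} (hj : Measurable j) (m : ℕ) :
    Integrable (fun g => if j g = m then (1 : ℝ) else 0) μ :=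
  Integrable.of_bound (C := 1) (Measurable.ite (hj (measurableSet_singleton m)) measurable_const
    measurable_const).aestronglyMeasurable (Eventually.of_forall fun g => by split_ifs <;> simp)

theorem integral_comp_eq_sum {j : G → ℕ} (hj : Measurable j) {N : ℕ} (hN : ∀ g, j g < N)
    (f : ℕ → ℝ) :
    ∫ g, f (j g) ∂μ = ∑ m ∈ Finset.range N, f m * ∫ g, (if j g = m then 1 else 0) ∂μ := by
  have h : ∀ g, f (j g) = ∑ m ∈ Finset.range N, f m * (if j g = m then 1 else 0) := fun g => by
    simp [hN g]
  simp_rw [h]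
  rw [integral_finsetSum _ fun m _ => (integrable_ite_eq hj m).const_mul _]
  simp_rw [integral_const_mul]

/-- The index of the level set of the step function `stepIndex k n / n`, which approximates the
nonnegative function `k` from below. -/
def stepIndex (k : G → ℝ) (n : ℕ) (g : G) : ℕ := if k g ≤ n then ⌊k g * n⌋₊ else 0

variable {k : G → ℝ}

theorem measurable_stepIndex (hk : Measurable k) (n : ℕ) : Measurable (stepIndex k n) :=
  Measurable.ite (measurableSet_le hk measurable_const) (hk.mul_const _).nat_floor measurable_const

theorem stepIndex_lt (n : ℕ) (g : G) : stepIndex k n g < n * n + 1 := by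
  unfold stepIndex
  split_ifs with h
  · have : ⌊k g * n⌋₊ ≤ ⌊((n * n : ℕ) : ℝ)⌋₊ := Nat.floor_le_floor (by push_cast; gcongr)
    rw [Nat.floor_natCast] at this
    omega
  · omega

theorem stepIndex_div_le (hk0 : ∀ g, 0 ≤ k g) (n : ℕ) (g : G) :
    (stepIndex k n g : ℝ) / n ≤ k g := by
  unfold stepIndex
  split_ifs
  · exact div_le_of_le_mul₀ (Nat.cast_nonneg n) (hk0 g)
      (Nat.floor_le (mul_nonneg (hk0 g) (Nat.cast_nonneg n)))
  · simpa using hk0 g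

theorem tendsto_stepIndex_div (hk0 : ∀ g, 0 ≤ k g) (g : G) :
    Tendsto (fun n : ℕ => (stepIndex k n g : ℝ) / n) atTop (𝓝 (k g)) := by
  refine ((tendsto_nat_floor_mul_div_atTop (hk0 g)).comp tendsto_natCast_atTop_atTop).congr' ?_
  filter_upwards [eventually_ge_atTop ⌈k g⌉₊] with n hn
  simp [stepIndex, Nat.ceil_le.1 hn]

/-- `t log t` is not monotone on `[0, 1]`, but there its modulus is at most `1`. The bound dominates
the entropies of all step approximations at once. -/
theorem abs_mul_log_le {s t : ℝ} (hs : 0 ≤ s) (hst : s ≤ t) :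
    |s * Real.log s| ≤ 1 + |t * Real.log t| := by
  rcases hs.eq_or_lt with rfl | hs
  · simp; positivity
  rcases le_total s 1 with h | h
  · have := Real.abs_log_mul_self_lt s hs h
    rw [mul_comm] at this
    linarith [abs_nonneg (t * Real.log t)]
  · have h1 : s * Real.log s ≤ t * Real.log t :=
      mul_le_mul hst (Real.log_le_log hs hst) (Real.log_nonneg h) (hs.le.trans hst)
    rw [abs_of_nonneg (mul_nonneg hs.le (Real.log_nonneg h))]
    linarith [le_abs_self (t * Real.log t)]

/-- Also valid at `t = 0`, where `0 ^ p = 0` for `p` near `1`; zero eigenvalues and zero values of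
the density need no separate care. -/
theorem hasDerivAt_rpow_exponent {t : ℝ} (ht : 0 ≤ t) :
    HasDerivAt (fun p : ℝ => t ^ p) (t * Real.log t) 1 := by
  rcases ht.eq_or_lt with rfl | h
  · have : (fun p : ℝ => (0 : ℝ) ^ p) =ᶠ[𝓝 1] fun _ => 0 := by
      filter_upwards [eventually_ne_nhds (one_ne_zero (α := ℝ))] with p hp
      exact Real.zero_rpow hp
    simpa using (hasDerivAt_const (1 : ℝ) (0 : ℝ)).congr_of_eventuallyEq this
  · simpa [mul_comm] using (hasDerivAt_id (1 : ℝ)).const_rpow h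

theorem deriv_le_of_le_right {f g : ℝ → ℝ} {f' g' a : ℝ} (hf : HasDerivAt f f' a)
    (hg : HasDerivAt g g' a) (hfg : f a = g a) (h : ∀ p, a < p → f p ≤ g p) : f' ≤ g' := by
  have hd := ((hasDerivAt_iff_tendsto_slope.1 (hg.sub hf)).mono_left
    (nhdsWithin_mono a (fun x (hx : a < x) => hx.ne') : 𝓝[>] a ≤ 𝓝[≠] a))
  refine sub_nonneg.1 (ge_of_tendsto hd ?_)
  filter_upwards [self_mem_nhdsWithin] with p hp
  rw [slope_def_field]
  refine div_nonneg ?_ (sub_nonneg.2 (le_of_lt hp))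
  simp only [Pi.sub_apply]
  linarith [h p hp]

end StepFunctions

/-! ### Trace inequalities for step densities, then for general densities. -/

section Averaging

open scoped ComplexOrder Topology
open Filter

set_option linter.unusedSectionVars false

variable {H : Type*} [NormedAddCommGroup H] [InnerProductSpace ℂ H] [CompleteSpace H]
  [FiniteDimensional ℂ H]
variable {G : Type*} [Group G] [TopologicalSpace G] [IsTopologicalGroup G] [CompactSpace G]
  [MeasurableSpace G] [BorelSpace G] {μ : Measure G} [IsProbabilityMeasure μ]
  {u : G → unitary (H →L[ℂ] H)} (hu : IsProjectiveRep u)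
include hu

theorem opTrace_transferMap {k : G → ℝ} (hk : Integrable k μ) (x : H →L[ℂ] H) :
    opTrace (transferMap μ u k x) = ((∫ g, k g ∂μ : ℝ) : ℂ) * opTrace x := by
  simpa using opTrace_transferMap_mul hu hk x (one_mem (fixedAlgebra u))

theorem opTrace_fixExpectation (x : H →L[ℂ] H) : opTrace (fixExpectation μ u x) = opTrace x := by
  rw [fixExpectation_eq_transferMap, opTrace_transferMap hu (integrable_const 1)]
  simp

theorem opTrace_rpow_transferMap_comp_le [μ.IsHaarMeasure] {X : H →L[ℂ] H} (hX : 0 ≤ X) {j : G → ℕ}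
    (hj : Measurable j) {N : ℕ} (hN : ∀ g, j g < N) {c : ℕ → ℝ} (hc : ∀ m, 0 ≤ c m)
    {p : ℝ} (hp : 1 < p) :
    (opTrace (transferMap μ u (fun g => c (j g)) X ^ p)).re ≤
      (∫ g, c (j g) ^ p ∂μ) * (opTrace (fixExpectation μ u X ^ p)).re := by
  set E := fixExpectation μ u X with hEdef
  have hE0 : 0 ≤ E := by
    rw [hEdef, fixExpectation_eq_transferMap]
    exact transferMap_nonneg (fun _ => zero_le_one) hX
  have hEm : E ∈ fixedAlgebra u := fixExpectation_mem hu X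
  have hint : ∀ m ∈ Finset.range N, Integrable (fun g => if j g = m then (1 : ℝ) else 0) μ :=
    fun m _ => integrable_ite_eq hj m
  have h1 := transferMap_sum hu (Finset.range N) c hint X
  have h2 := transferMap_sum hu (Finset.range N) (fun _ => 1) hint X
  simp only [mul_ite, mul_one, mul_zero, Finset.sum_ite_eq, Finset.mem_range, hN, if_true,
    Complex.ofReal_one, one_smul, ← fixExpectation_eq_transferMap, ← hEdef] at h1 h2
  have key := opTrace_sum_rpow_le (Finset.range N)
    (fun m => transferMap μ u (fun g => if j g = m then (1 : ℝ) else 0) X)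
    (fun m _ => transferMap_nonneg (fun g => by split_ifs <;> simp) hX) c (fun m _ => hc m) hp
  rw [h1, h2] at key
  have hXE : opTrace (X * E ^ (p - 1)) = opTrace (E ^ p) := by
    have := opTrace_transferMap_mul hu (μ := μ) (integrable_const 1) X
      (rpow_mem_fixedAlgebra hEm hE0 (p - 1))
    rw [← fixExpectation_eq_transferMap, ← hEdef, mul_rpow_sub_one hE0 hp] at this
    simpa using this.symm
  refine key.trans_eq ?_
  rw [integral_comp_eq_sum hj hN (fun m => c m ^ p), Finset.sum_mul]
  refine Finset.sum_congr rfl fun m hm => ?_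
  rw [opTrace_transferMap_mul hu (hint m hm) X (rpow_mem_fixedAlgebra hEm hE0 (p - 1)), hXE,
    Complex.re_ofReal_mul, mul_assoc]

/-- Both sides of the power inequality agree at `p = 1`, by the trace formulas for `Φ_k` and `E`.
Their derivatives there are therefore ordered, and the product rule on the right gives the two
terms. -/
theorem opTrace_mul_log_transferMap_comp_le [μ.IsHaarMeasure] {X : H →L[ℂ] H} (hX : 0 ≤ X)
    {j : G → ℕ} (hj : Measurable j) {N : ℕ} (hN : ∀ g, j g < N) {c : ℕ → ℝ} (hc : ∀ m, 0 ≤ c m) :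
    (opTrace (cfc (fun x : ℝ => x * Real.log x) (transferMap μ u (fun g => c (j g)) X))).re ≤
      (∫ g, c (j g) * Real.log (c (j g)) ∂μ) * (opTrace X).re + (∫ g, c (j g) ∂μ) *
        (opTrace (cfc (fun x : ℝ => x * Real.log x) (fixExpectation μ u X))).re := by
  have hE0 : 0 ≤ fixExpectation μ u X := by
    rw [fixExpectation_eq_transferMap]
    exact transferMap_nonneg (fun _ => zero_le_one) hX
  have hA0 : 0 ≤ transferMap μ u (fun g => c (j g)) X := transferMap_nonneg (fun g => hc _) hX
  have hle := fun p (hp : 1 < p) =>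
    opTrace_rpow_transferMap_comp_le (μ := μ) hu hX hj hN hc (p := p) hp
  have hk : Integrable (fun g => c (j g)) μ := by
    refine Integrable.of_bound (C := ∑ m ∈ Finset.range N, c m)
      ((measurable_of_countable c).comp hj).aestronglyMeasurable (Eventually.of_forall fun g => ?_)
    rw [Real.norm_of_nonneg (hc _)]
    exact Finset.single_le_sum (f := c) (fun m _ => hc m) (Finset.mem_range.2 (hN g))
  have htA := opTrace_transferMap hu hk X
  have htE := opTrace_fixExpectation (μ := μ) hu X
  obtain ⟨b, a, ha, hb⟩ := exists_eigenbasis hA0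
  obtain ⟨e, ε, hε, he⟩ := exists_eigenbasis hE0
  have htA' := opTrace_rpow hA0 b hb 1
  have htE' := opTrace_rpow hE0 e he 1
  rw [CFC.rpow_one _ hA0, htA] at htA'
  rw [CFC.rpow_one _ hE0, htE] at htE'
  have hre : (opTrace X).re = ∑ i, ε i ^ (1 : ℝ) := by rw [htE', Complex.ofReal_re]
  have hval : ∑ i, a i ^ (1 : ℝ) = (∫ g, c (j g) ∂μ) * ∑ i, ε i ^ (1 : ℝ) := by
    rw [htE', ← Complex.ofReal_mul] at htA'
    exact (Complex.ofReal_injective htA').symm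
  rw [opTrace_cfc hA0.isSelfAdjoint b hb, opTrace_cfc hE0.isSelfAdjoint e he, hre,
    Complex.ofReal_re, Complex.ofReal_re]
  simp only [opTrace_rpow hA0 b hb, opTrace_rpow hE0 e he, Complex.ofReal_re] at hle
  rw [integral_comp_eq_sum hj hN c] at hval ⊢
  rw [integral_comp_eq_sum hj hN fun m => c m * Real.log (c m)]
  have hle' : ∀ p : ℝ, 1 < p → ∑ i, a i ^ p ≤ (∑ m ∈ Finset.range N, c m ^ p *
      ∫ g, (if j g = m then 1 else 0) ∂μ) * ∑ i, ε i ^ p := fun p hp => by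
    rw [← integral_comp_eq_sum hj hN fun m => c m ^ p]
    exact hle p hp
  have hd1 : HasDerivAt (fun p : ℝ => ∑ i, a i ^ p) (∑ i, a i * Real.log (a i)) 1 :=
    HasDerivAt.fun_sum fun i _ => hasDerivAt_rpow_exponent (ha i)
  have hd2 : HasDerivAt (fun p : ℝ => ∑ i, ε i ^ p) (∑ i, ε i * Real.log (ε i)) 1 :=
    HasDerivAt.fun_sum fun i _ => hasDerivAt_rpow_exponent (hε i)
  have hd3 : HasDerivAt (fun p : ℝ => ∑ m ∈ Finset.range N, c m ^ p *
      ∫ g, (if j g = m then 1 else 0) ∂μ) (∑ m ∈ Finset.range N, c m * Real.log (c m) *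
      ∫ g, (if j g = m then 1 else 0) ∂μ) 1 :=
    HasDerivAt.fun_sum fun m _ => (hasDerivAt_rpow_exponent (hc m)).mul_const _
  have := deriv_le_of_le_right hd1 (hd3.mul hd2) (by simpa using hval) hle'
  simpa using this

theorem tendsto_transferMap_stepIndex {k : G → ℝ} (hkm : Measurable k) (hk0 : ∀ g, 0 ≤ k g)
    (hk : Integrable k μ) (X : H →L[ℂ] H) :
    Tendsto (fun n : ℕ => transferMap μ u (fun g => (stepIndex k n g : ℝ) / n) X) atTop
      (𝓝 (transferMap μ u k X)) := by
  refine tendsto_integral_of_dominated_convergence (fun g => k g * ‖X‖) (fun n => ?_)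
    (hk.mul_const _) (fun n => Eventually.of_forall fun g => ?_)
    (Eventually.of_forall fun g => ?_)
  · have hm : AEStronglyMeasurable (fun g => (((stepIndex k n g : ℝ) / n : ℝ) : ℂ)) μ :=
      (Complex.measurable_ofReal.comp ((measurable_from_top.comp
        (measurable_stepIndex hkm n)).div_const _)).aestronglyMeasurable
    exact hm.smul (aestronglyMeasurable_conjAct hu X)
  · change ‖_ • conjAct u X g‖ ≤ _
    rw [norm_smul, norm_conjAct, Complex.norm_real, Real.norm_of_nonneg (by positivity)]
    exact mul_le_mul_of_nonneg_right (stepIndex_div_le hk0 n g) (norm_nonneg _)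
  · exact ((Complex.continuous_ofReal.tendsto _).comp (tendsto_stepIndex_div hk0 g)).smul_const _

/-- The approximants lie below `k`, so the right side is bounded by monotonicity and only the left
side needs a limit. -/
theorem opTrace_rpow_transferMap_le [μ.IsHaarMeasure] {k : G → ℝ} (hkm : Measurable k)
    (hk0 : ∀ g, 0 ≤ k g) (hk : Integrable k μ) {X : H →L[ℂ] H} (hX : 0 ≤ X) {p : ℝ} (hp : 1 < p)
    (hkp : Integrable (fun g => k g ^ p) μ) :
    (opTrace (transferMap μ u k X ^ p)).re ≤
      (∫ g, k g ^ p ∂μ) * (opTrace (fixExpectation μ u X ^ p)).re := by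
  have hA0 : ∀ n : ℕ, 0 ≤ transferMap μ u (fun g => (stepIndex k n g : ℝ) / n) X := fun n =>
    transferMap_nonneg (fun g => by positivity) hX
  have hE0 : 0 ≤ fixExpectation μ u X := by
    rw [fixExpectation_eq_transferMap]
    exact transferMap_nonneg (fun _ => zero_le_one) hX
  have hlim := (Complex.continuous_re.tendsto _).comp (tendsto_opTrace_cfc
    (fun n => (hA0 n).isSelfAdjoint) (transferMap_nonneg hk0 hX).isSelfAdjoint
    (tendsto_transferMap_stepIndex (μ := μ) hu hkm hk0 hk X)
    (Real.continuous_rpow_const (by linarith : 0 ≤ p)))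
  rw [← CFC.rpow_eq_cfc_real (transferMap_nonneg hk0 hX)] at hlim
  refine le_of_tendsto' hlim fun n => ?_
  simp only [Function.comp_apply]
  rw [← CFC.rpow_eq_cfc_real (hA0 n)]
  refine (opTrace_rpow_transferMap_comp_le hu hX (measurable_stepIndex hkm n) (stepIndex_lt n)
    (c := fun m => (m : ℝ) / n) (fun m => by positivity) hp).trans ?_
  refine mul_le_mul_of_nonneg_right ?_ ?_
  · refine integral_mono_of_nonneg (Eventually.of_forall fun g => by positivity) hkp
      (Eventually.of_forall fun g => ?_)
    exact Real.rpow_le_rpow (by positivity) (stepIndex_div_le hk0 n g) (by linarith)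
  · obtain ⟨e, ε, hε, he⟩ := exists_eigenbasis hE0
    rw [opTrace_rpow hE0 e he, Complex.ofReal_re]
    exact Finset.sum_nonneg fun i _ => Real.rpow_nonneg (hε i) _

/-- Without monotonicity of `t log t`, and with `Tr E(X) log E(X)` of either sign, the integrals on
the right must converge too. -/
theorem opTrace_mul_log_transferMap_le [μ.IsHaarMeasure] {k : G → ℝ} (hkm : Measurable k)
    (hk0 : ∀ g, 0 ≤ k g) (hk : Integrable k μ) {X : H →L[ℂ] H} (hX : 0 ≤ X)
    (hkl : Integrable (fun g => k g * Real.log (k g)) μ) :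
    (opTrace (cfc (fun x : ℝ => x * Real.log x) (transferMap μ u k X))).re ≤
      (∫ g, k g * Real.log (k g) ∂μ) * (opTrace X).re + (∫ g, k g ∂μ) *
        (opTrace (cfc (fun x : ℝ => x * Real.log x) (fixExpectation μ u X))).re := by
  have hA0 : ∀ n : ℕ, 0 ≤ transferMap μ u (fun g => (stepIndex k n g : ℝ) / n) X := fun n =>
    transferMap_nonneg (fun g => by positivity) hX
  have hlim := (Complex.continuous_re.tendsto _).comp (tendsto_opTrace_cfc
    (fun n => (hA0 n).isSelfAdjoint) (transferMap_nonneg hk0 hX).isSelfAdjoint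
    (tendsto_transferMap_stepIndex hu hkm hk0 hk X) Real.continuous_mul_log)
  have hm : ∀ n, Measurable fun g => (stepIndex k n g : ℝ) / n := fun n =>
    (measurable_from_top.comp (measurable_stepIndex hkm n)).div_const _
  have h1 : Tendsto (fun n : ℕ => ∫ g, (stepIndex k n g : ℝ) / n ∂μ) atTop (𝓝 (∫ g, k g ∂μ)) := by
    refine tendsto_integral_of_dominated_convergence k (fun n => (hm n).aestronglyMeasurable) hk
      (fun n => Eventually.of_forall fun g => ?_)
      (Eventually.of_forall (tendsto_stepIndex_div hk0))
    rw [Real.norm_of_nonneg (by positivity)]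
    exact stepIndex_div_le hk0 n g
  have h2 : Tendsto (fun n : ℕ => ∫ g, (stepIndex k n g : ℝ) / n *
      Real.log ((stepIndex k n g : ℝ) / n) ∂μ) atTop (𝓝 (∫ g, k g * Real.log (k g) ∂μ)) := by
    refine tendsto_integral_of_dominated_convergence (fun g => 1 + |k g * Real.log (k g)|)
      (fun n => (Real.continuous_mul_log.measurable.comp (hm n)).aestronglyMeasurable)
      ((integrable_const 1).add hkl.abs) (fun n => Eventually.of_forall fun g => ?_)
      (Eventually.of_forall fun g => ?_)
    · exact abs_mul_log_le (by positivity) (stepIndex_div_le hk0 n g)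
    · exact (Real.continuous_mul_log.tendsto _).comp (tendsto_stepIndex_div hk0 g)
  exact le_of_tendsto_of_tendsto' hlim ((h2.mul_const _).add (h1.mul_const _)) fun n =>
    opTrace_mul_log_transferMap_comp_le hu hX (measurable_stepIndex hkm n) (stepIndex_lt n)
      (c := fun m => (m : ℝ) / n) (fun m => by positivity)

end Averaging

/-! ### Schatten norms of positive operators. -/

section SchattenNorm

set_option linter.unusedSectionVars false

variable {H : Type*} [NormedAddCommGroup H] [InnerProductSpace ℂ H] [CompleteSpace H]
  [FiniteDimensional ℂ H]

theorem schattenNorm_of_nonneg {A : H →L[ℂ] H} (hA : 0 ≤ A) {p : ℝ≥0∞} (hp : p ≠ ∞) :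
    schattenNorm p A = (opTrace (A ^ p.toReal)).re ^ (1 / p.toReal) := by
  rw [schattenNorm, if_neg hp, CFC.abs_of_nonneg A hA]

theorem opTrace_rpow_nonneg {A : H →L[ℂ] H} (hA : 0 ≤ A) (p : ℝ) :
    0 ≤ (opTrace (A ^ p)).re := by
  obtain ⟨b, t, ht, hb⟩ := exists_eigenbasis hA
  rw [opTrace_rpow hA b hb, Complex.ofReal_re]
  exact Finset.sum_nonneg fun i _ => Real.rpow_nonneg (ht i) _

theorem eq_zero_of_opTrace_rpow_eq_zero {A : H →L[ℂ] H} (hA : 0 ≤ A) {p : ℝ} (hp : p ≠ 0)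
    (h : (opTrace (A ^ p)).re = 0) : A = 0 := by
  obtain ⟨b, t, ht, hb⟩ := exists_eigenbasis hA
  rw [opTrace_rpow hA b hb, Complex.ofReal_re,
    Finset.sum_eq_zero_iff_of_nonneg fun i _ => Real.rpow_nonneg (ht i) _] at h
  refine ext_basis b fun i => ?_
  rw [hb, (Real.rpow_eq_zero (ht i) hp).1 (h i (Finset.mem_univ i))]
  simp

theorem schattenNorm_pos {A : H →L[ℂ] H} (hA : 0 ≤ A) (hA0 : A ≠ 0) {p : ℝ≥0∞} (hp : p ≠ 0) :
    0 < schattenNorm p A := by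
  by_cases hp' : p = ∞
  · simpa [schattenNorm, hp'] using hA0
  · rw [schattenNorm_of_nonneg hA hp']
    refine Real.rpow_pos_of_pos ((opTrace_rpow_nonneg hA _).lt_of_ne fun h => hA0 ?_) _
    exact eq_zero_of_opTrace_rpow_eq_zero hA (ENNReal.toReal_pos hp hp').ne' h.symm

theorem schattenNorm_zero {p : ℝ≥0∞} (hp : p ≠ 0) : schattenNorm p (0 : H →L[ℂ] H) = 0 := by
  by_cases hp' : p = ∞
  · simp [schattenNorm, hp']
  · have hp0 := ENNReal.toReal_pos hp hp'
    obtain ⟨b, t, ht, hb⟩ := exists_eigenbasis (le_refl (0 : H →L[ℂ] H))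
    rw [schattenNorm_of_nonneg le_rfl hp', opTrace_rpow le_rfl b (t := fun _ => 0) (by simp)]
    simp [Real.zero_rpow hp0.ne', hp0.ne']

theorem mul_log_eq_cfc {A : H →L[ℂ] H} (hA : 0 ≤ A) :
    A * CFC.log A = cfc (fun x : ℝ => x * Real.log x) A := by
  obtain ⟨b, t, ht, hb⟩ := exists_eigenbasis hA
  refine ext_basis b fun i => ?_
  rw [mul_apply_eq_comp, CFC.log, cfc_apply_eigenvector hA.isSelfAdjoint _ (hb i),
    cfc_apply_eigenvector hA.isSelfAdjoint _ (hb i), map_smul, hb, smul_smul, mul_comm,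
    Complex.ofReal_mul]

end SchattenNorm

/-! ### Weights, Schatten norm bounds and relative entropy. -/

section Averaging

open scoped ComplexOrder Topology InnerProductSpace
open Filter

set_option linter.unusedSectionVars false

variable {H : Type*} [NormedAddCommGroup H] [InnerProductSpace ℂ H] [CompleteSpace H]
  [FiniteDimensional ℂ H]
variable {G : Type*} [Group G] [TopologicalSpace G] [IsTopologicalGroup G] [CompactSpace G]
  [MeasurableSpace G] [BorelSpace G] {μ : Measure G} [IsProbabilityMeasure μ]
  {u : G → unitary (H →L[ℂ] H)}

theorem fixExpectation_nonneg {X : H →L[ℂ] H} (hX : 0 ≤ X) : 0 ≤ fixExpectation μ u X := by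
  rw [fixExpectation_eq_transferMap]
  exact transferMap_nonneg (fun _ => zero_le_one) hX

theorem weighted_nonneg (q : ℝ≥0∞) {σ X : H →L[ℂ] H} (hX : 0 ≤ X) : 0 ≤ weighted q σ X := by
  have h : 0 ≤ σ ^ (-(q⁻¹.toReal / 2)) := CFC.rpow_nonneg
  have := star_left_conjugate_nonneg hX (σ ^ (-(q⁻¹.toReal / 2)))
  rwa [h.isSelfAdjoint.star_eq] at this

variable (hu : IsProjectiveRep u)
include hu

theorem weighted_transferMap {k : G → ℝ} (hk : Integrable k μ) (q : ℝ≥0∞) {σ : H →L[ℂ] H}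
    (hσ : σ ∈ fixedAlgebra u) (hσ0 : 0 ≤ σ) (X : H →L[ℂ] H) :
    weighted q σ (transferMap μ u k X) = transferMap μ u k (weighted q σ X) :=
  (transferMap_mul_mul hu hk X (rpow_mem_fixedAlgebra hσ hσ0 _)).symm

theorem weighted_fixExpectation (q : ℝ≥0∞) {σ : H →L[ℂ] H}
    (hσ : σ ∈ fixedAlgebra u) (hσ0 : 0 ≤ σ) (X : H →L[ℂ] H) :
    weighted q σ (fixExpectation μ u X) = fixExpectation μ u (weighted q σ X) := by
  simp only [fixExpectation_eq_transferMap]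
  exact weighted_transferMap hu (integrable_const 1) q hσ hσ0 X

theorem fixExpectation_ne_zero {X : H →L[ℂ] H} (hX : 0 ≤ X) (hX0 : X ≠ 0) :
    fixExpectation μ u X ≠ 0 := by
  intro h
  refine hX0 (eq_zero_of_opTrace_rpow_eq_zero hX one_ne_zero ?_)
  rw [CFC.rpow_one _ hX, ← opTrace_fixExpectation (μ := μ) hu X, h]
  simp [opTrace]

theorem transferMap_le_smul_fixExpectation {k : G → ℝ} (hk : Integrable k μ) {X : H →L[ℂ] H}
    (hX : 0 ≤ X) {C : ℝ} (hC : ∀ᵐ g ∂μ, k g ≤ C) :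
    transferMap μ u k X ≤ (C : ℂ) • fixExpectation μ u X := by
  have h : (C : ℂ) • fixExpectation μ u X = transferMap μ u (fun _ => C) X := by
    rw [transferMap_eq, integral_smul]
    rfl
  rw [h, transferMap_eq, transferMap_eq]
  refine integral_mono_ae (integrable_smul_conjAct hu hk X)
    (integrable_smul_conjAct hu (integrable_const C) X) ?_
  filter_upwards [hC] with g hg
  exact smul_le_smul_of_nonneg_right (by exact_mod_cast hg) (conjAct_nonneg hX g)

theorem opTrace_rpow_transferMap_le_of_one_le [μ.IsHaarMeasure] {k : G → ℝ} (hkm : Measurable k)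
    (hk0 : ∀ g, 0 ≤ k g) (hk : Integrable k μ) {X : H →L[ℂ] H} (hX : 0 ≤ X) {p : ℝ} (hp : 1 ≤ p)
    (hkp : Integrable (fun g => k g ^ p) μ) :
    (opTrace (transferMap μ u k X ^ p)).re ≤
      (∫ g, k g ^ p ∂μ) * (opTrace (fixExpectation μ u X ^ p)).re := by
  rcases hp.eq_or_lt with rfl | hp
  · simp only [CFC.rpow_one _ (transferMap_nonneg hk0 hX), CFC.rpow_one _ (fixExpectation_nonneg hX),
      Real.rpow_one, opTrace_transferMap hu hk, opTrace_fixExpectation hu, Complex.re_ofReal_mul,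
      le_refl]
  · exact opTrace_rpow_transferMap_le hu hkm hk0 hk hX hp hkp

theorem schattenNorm_transferMap_le [μ.IsHaarMeasure] {k : G → ℝ} (hkm : Measurable k)
    (hk0 : ∀ g, 0 ≤ k g) (hk : Integrable k μ) {X : H →L[ℂ] H} (hX : 0 ≤ X) {p : ℝ≥0∞}
    (hp : 1 ≤ p) :
    ENNReal.ofReal (schattenNorm p (transferMap μ u k X)) ≤
      eLpNorm k p μ * ENNReal.ofReal (schattenNorm p (fixExpectation μ u X)) := by
  have hp0 : p ≠ 0 := (one_pos.trans_le hp).ne'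
  have hA := transferMap_nonneg (μ := μ) (u := u) hk0 hX
  have hE := fixExpectation_nonneg (μ := μ) (u := u) hX
  -- Split off because of `∞ * 0 = 0`: for `X ≠ 0` trace preservation makes the norm of `E(X)`
  -- positive, so an infinite norm of `k` makes the right side infinite.
  by_cases hX0 : X = 0
  · simp [hX0, transferMap, schattenNorm_zero hp0]
  have hpos := schattenNorm_pos hE (fixExpectation_ne_zero (μ := μ) hu hX hX0) hp0
  by_cases htop : eLpNorm k p μ = ∞
  · rw [htop, ENNReal.top_mul (ENNReal.ofReal_pos.2 hpos).ne']
    exact le_top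
  have hmem : MemLp k p μ := ⟨hkm.aestronglyMeasurable, lt_top_iff_ne_top.2 htop⟩
  by_cases hp' : p = ∞
  · subst hp'
    have hC : ∀ᵐ g ∂μ, k g ≤ (eLpNorm k ∞ μ).toReal := by
      rw [eLpNorm_exponent_top] at htop ⊢
      filter_upwards [ae_le_eLpNormEssSup (f := k) (μ := μ)] with g hg
      have := ENNReal.toReal_mono htop hg
      rw [toReal_enorm] at this
      exact (Real.le_norm_self _).trans this
    have h := CStarAlgebra.norm_le_norm_of_nonneg_of_le hA
      (transferMap_le_smul_fixExpectation hu hk hX hC)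
    rw [norm_smul, Complex.norm_real, Real.norm_of_nonneg ENNReal.toReal_nonneg] at h
    rw [schattenNorm, schattenNorm, if_pos rfl, if_pos rfl]
    conv_rhs => rw [← ENNReal.ofReal_toReal htop, ← ENNReal.ofReal_mul ENNReal.toReal_nonneg]
    exact ENNReal.ofReal_le_ofReal h
  have hp1 : 1 ≤ p.toReal := by
    simpa using ENNReal.toReal_mono hp' hp
  have hnorm : ∀ g, ‖k g‖ = k g := fun g => Real.norm_of_nonneg (hk0 g)
  have hkp : Integrable (fun g => k g ^ p.toReal) μ := by
    simpa only [hnorm] using hmem.integrable_norm_rpow hp0 hp'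
  have hI : 0 ≤ ∫ g, k g ^ p.toReal ∂μ := integral_nonneg fun g => Real.rpow_nonneg (hk0 g) _
  rw [hmem.eLpNorm_eq_integral_rpow_norm hp0 hp', schattenNorm_of_nonneg hA hp',
    schattenNorm_of_nonneg hE hp']
  simp only [hnorm]
  rw [← ENNReal.ofReal_mul (Real.rpow_nonneg hI _), ← one_div,
    ← Real.mul_rpow hI (opTrace_rpow_nonneg hE _)]
  refine ENNReal.ofReal_le_ofReal (Real.rpow_le_rpow (opTrace_rpow_nonneg hA _) ?_ (by positivity))
  exact opTrace_rpow_transferMap_le_of_one_le hu hkm hk0 hk hX hp1 hkp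

/-- If `E(X) v = 0`, the nonnegative function `⟪v, conjAct u X g v⟫` has integral zero, so `conjAct
u X g v = 0` for almost every `g`, whatever the density. Thus finiteness of the right-hand
divergence passes to the left. -/
theorem ker_fixExpectation_le_ker_transferMap {k : G → ℝ} {X : H →L[ℂ] H} (hX : 0 ≤ X) {v : H}
    (hk : Integrable k μ) (hv : fixExpectation μ u X v = 0) : transferMap μ u k X v = 0 := by
  have hint : Integrable (conjAct u X) μ := by
    simpa using integrable_smul_conjAct hu (k := fun _ => 1) (integrable_const 1) X
  have hint1 : Integrable (fun g => conjAct u X g v) μ := hint.apply_continuousLinearMap v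
  have hint2 : Integrable (fun g => ⟪v, conjAct u X g v⟫_ℂ) μ := hint1.const_inner v
  have h3 : ∫ g, (⟪v, conjAct u X g v⟫_ℂ).re ∂μ = 0 := by
    have h5 : ∫ g, (⟪v, conjAct u X g v⟫_ℂ).re ∂μ = (∫ g, ⟪v, conjAct u X g v⟫_ℂ ∂μ).re :=
      integral_re hint2
    have h6 : ∫ g, conjAct u X g v ∂μ = fixExpectation μ u X v :=
      (ContinuousLinearMap.integral_apply hint v).symm
    rw [h5, integral_inner hint1, h6, hv, inner_zero_right, Complex.zero_re]
  have h4 : (fun g => (⟪v, conjAct u X g v⟫_ℂ).re) =ᵐ[μ] 0 :=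
    (integral_eq_zero_iff_of_nonneg (fun g => re_inner_nonneg (conjAct_nonneg hX g) v)
      hint2.re).1 h3
  rw [transferMap_eq, ContinuousLinearMap.integral_apply (integrable_smul_conjAct hu hk X)]
  refine integral_eq_zero_of_ae ?_
  filter_upwards [h4] with g hg
  have h7 := apply_eq_zero_of_inner_eq_zero (conjAct_nonneg hX g) hg
  simp [h7]

theorem relEntropy_transferMap_le [μ.IsHaarMeasure] {k : G → ℝ} (hkm : Measurable k)
    (hk0 : ∀ g, 0 ≤ k g) (hk1 : ∫ g, k g ∂μ = 1) {σ ρ : H →L[ℂ] H} (hσ : σ ∈ fixedAlgebra u)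
    (hρ : IsState ρ) :
    relEntropy (transferMap μ u k ρ) σ ≤
      relEntropy (fixExpectation μ u ρ) σ + entropyIntegral μ k := by
  have hk : Integrable k μ := by
    -- The integral of a non-integrable function is `0` by default, so total mass `1` forces
    -- integrability.
    by_contra h
    rw [integral_undef h] at hk1
    exact zero_ne_one hk1
  have hA := transferMap_nonneg (μ := μ) (u := u) hk0 hρ.1
  have hE := fixExpectation_nonneg (μ := μ) (u := u) hρ.1
  unfold relEntropy
  by_cases hker : (σ : H →ₗ[ℂ] H).ker ≤ (fixExpectation μ u ρ : H →ₗ[ℂ] H).ker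
  · have hker' : (σ : H →ₗ[ℂ] H).ker ≤ (transferMap μ u k ρ : H →ₗ[ℂ] H).ker := fun v hv =>
      ker_fixExpectation_le_ker_transferMap hu hρ.1 hk (hker hv)
    rw [if_pos hker, if_pos hker', entropyIntegral]
    split_ifs with hkl
    · rw [← EReal.coe_add, EReal.coe_le_coe_iff]
      have hL : CFC.log σ ∈ fixedAlgebra u := cfc_mem_fixedAlgebra hσ _
      have h1 := opTrace_transferMap_mul hu hk ρ hL
      have h2 := opTrace_transferMap_mul hu (μ := μ) (integrable_const 1) ρ hL
      rw [← fixExpectation_eq_transferMap] at h2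
      have hsub : ∀ x y : H →L[ℂ] H, opTrace (x - y) = opTrace x - opTrace y := fun x y => by
        simp [opTrace]
      have key := opTrace_mul_log_transferMap_le hu hkm hk0 hk hρ.1 hkl
      rw [hk1, hρ.2, ← mul_log_eq_cfc hA, ← mul_log_eq_cfc hE] at key
      -- Both cross terms become `Tr (ρ log σ)`, leaving only the entropy inequality `key`.
      rw [mul_sub, mul_sub, hsub, hsub, h1, h2, hk1]
      simp only [Complex.one_re, mul_one, one_mul, Complex.sub_re, integral_const,
        probReal_univ, smul_eq_mul, Complex.ofReal_one] at key ⊢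
      linarith
    · rw [EReal.coe_add_top]
      exact le_top
  · rw [if_neg hker, EReal.top_add_of_ne_bot]
    · exact le_top
    · unfold entropyIntegral
      split_ifs
      · exact EReal.coe_ne_bot _
      · exact top_ne_bot

end Averaging

end Transference

end

theorem mainTheorem1
    {G : Type*} [Group G] [TopologicalSpace G] [IsTopologicalGroup G] [CompactSpace G] [T2Space G]
    [MeasurableSpace G] [BorelSpace G]
    (μ : Measure G) [μ.IsHaarMeasure] [μ.Regular] [IsProbabilityMeasure μ]
    {H : Type*} [NormedAddCommGroup H] [InnerProductSpace ℂ H] [CompleteSpace H]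
    [FiniteDimensional ℂ H]
    (u : G → unitary (H →L[ℂ] H)) (hu : Transference.IsProjectiveRep u)
    (k : G → ℝ) (hk_meas : Measurable k) (hk_nonneg : ∀ g, 0 ≤ k g) (hk_int : ∫ g, k g ∂μ = 1) :
    (∀ σ : H →L[ℂ] H, σ ∈ Transference.fixedAlgebra u → 0 ≤ σ →
      ∀ ρ : H →L[ℂ] H, 0 ≤ ρ →
      ∀ p q : ℝ≥0∞, ENNReal.HolderConjugate p q →
        ENNReal.ofReal (Transference.schattenNorm p
            (Transference.weighted q σ (Transference.transferMap μ u k ρ))) ≤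
          eLpNorm k p μ *
            ENNReal.ofReal (Transference.schattenNorm p
              (Transference.weighted q σ (Transference.fixExpectation μ u ρ)))) ∧
    (∀ σ : H →L[ℂ] H, σ ∈ Transference.fixedAlgebra u → Transference.IsState σ →
      ∀ ρ : H →L[ℂ] H, Transference.IsState ρ →
        Transference.relEntropy (Transference.transferMap μ u k ρ) σ ≤
          Transference.relEntropy (Transference.fixExpectation μ u ρ) σ +
            Transference.entropyIntegral μ k) := by
  refine ⟨fun σ hσ hσ0 ρ hρ p q hpq => ?_, fun σ hσ _ ρ hρ =>
    Transference.relEntropy_transferMap_le hu hk_meas hk_nonneg hk_int hσ hρ⟩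
  have hk : Integrable k μ := by
    by_contra h
    rw [integral_undef h] at hk_int
    exact zero_ne_one hk_int
  rw [Transference.weighted_transferMap hu hk q hσ hσ0,
    Transference.weighted_fixExpectation hu q hσ hσ0]
  exact Transference.schattenNorm_transferMap_le hu hk_meas hk_nonneg hk
    (Transference.weighted_nonneg q hρ) (ENNReal.HolderConjugate.one_le p q)
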